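/- Let $n\ge 1$ be an integer. For positive integers $k_1,\dots,k_r$ put \[ T_n(k_1,\dots,k_r)=\int_{[0,1]^{k_1+\cdots+k_r}}\ \prod_{j=1}^{r}\Big(\sum_{m=0}^{n}\big(x_1x_2\cdots x_{k_1+\cdots+k_j}\big)^m\Big)\,dx_1\,dx_2\cdots dx_{k_1+\cdots+k_r}. \] Let $\widehat{\mathcal T}$ be the set of all infinite sequences $\mathbf k=(k_1,k_2,\dots)$ of positive integers, let $\widehat{\mathcal T}_2$ be the set of those with $k_i\ge 2$ for all $i\ge1$, and let $\widehat{\mathcal T}^{R}$ be the set of those $\mathbf k\in\widehat{\mathcal T}$ for which there is an index $s$ with $k_s\ge 2$ and $k_i=1$ for all $i>s$. For $\mathbf k,\mathbf l\in\widehat{\mathcal T}$ write $\mathbf k\succ\mathbf l$ if there is an $r\ge 1$ with $k_i=l_i$ for all $i<r$ and $k_r<l_r$. Then for every $\mathbf k\in\widehat{\mathcal T}$ the limit $\eta_n(\mathbf k)=\lim_{r\to\infty}T_n(k_1,\dots,k_r)$ exists in $\mathbb R$ and is greater than $1$, and the resulting map $\eta_n:\widehat{\mathcal T}\to(1,+\infty)$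 has the following properties. (i) $\eta_n(\widehat{\mathcal T}\setminus\widehat{\mathcal T}^{R})=\big(1,e^{1+\frac12+\cdots+\frac1n}\big]$, $\ \eta_n(\widehat{\mathcal T}^{R})\subseteq\big(1,e^{1+\frac12+\cdots+\frac1n}\big)$, and $\eta_n\big((1,1,1,\dots)\big)=e^{1+\frac12+\cdots+\frac1n}$. (ii) For $\mathbf k,\mathbf l\in\widehat{\mathcal T}_2$, $\ \eta_n(\mathbf k)>\eta_n(\mathbf l)$ if and only if $\mathbf k\succ\mathbf l$. (iii) The Hausdorff dimension of $\eta_n(\widehat{\mathcal T}_2)\subseteq\mathbb R$ is \[ \dim_{\mathrm H}\eta_n(\widehat{\mathcal T}_2)=\frac{\log\frac{1+\sqrt5}{2}}{\log 2}. \] -/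

import Mathlib

open Filter Topology MeasureTheory

namespace RatDef

/-- The set of all infinite sequences of positive integers. Sequences `(k₁, k₂, …)` are indexed
from `0`, so that `k i` is the entry `k_{i+1}`. -/
def THat : Set (ℕ → ℕ) := {k | ∀ i, 1 ≤ k i}

/-- The sequences all of whose entries are at least `p`. -/
def THatGe (p : ℕ) : Set (ℕ → ℕ) := {k | ∀ i, p ≤ k i}

/-- The terminating sequences: sequences of positive integers with an entry `≥ 2` after which
all entries are equal to `1`. -/
def THatR : Set (ℕ → ℕ) :=
  {k | (∀ i, 1 ≤ k i) ∧ ∃ s, 2 ≤ k s ∧ ∀ i, s < i → k i = 1}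

/-- The order `k ≻ l`: the lexicographic order induced by the reversed order of the
positive integers, i.e. at the first index where they differ, `k` has the smaller entry. -/
def LexSucc (k l : ℕ → ℕ) : Prop := ∃ r, (∀ i, i < r → k i = l i) ∧ k r < l r

/-- `weight k j = k₁ + ⋯ + k_j`, the sum of the first `j` entries. -/
def weight (k : ℕ → ℕ) (j : ℕ) : ℕ := ∑ i ∈ Finset.range j, k i

/-- `T n k r` is `T_n(k₁, …, k_r)`: the integral over the cube `[0,1]^(k₁+⋯+k_r)` of
`∏_{j=1}^{r} (1 + p_j + p_j² + ⋯ + p_j^n)` with `p_j = x₁ x₂ ⋯ x_{k₁+⋯+k_j}`.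
Only the first `r` entries of `k` matter. -/
noncomputable def T (n : ℕ) (k : ℕ → ℕ) (r : ℕ) : ℝ :=
  ∫ x in (Set.univ.pi fun _ => Set.Icc 0 1 : Set (Fin (weight k r) → ℝ)),
    ∏ j ∈ Finset.Icc 1 r, ∑ m ∈ Finset.range (n + 1),
      (∏ i with Fin.val i < weight k j, x i) ^ m

/-- `eta n k = lim_{r → ∞} T_n(k₁, …, k_r)`. -/
noncomputable def eta (n : ℕ) (k : ℕ → ℕ) : ℝ := limUnder atTop (fun r => T n k r)

/-- The `n`-th harmonic number `1 + 1/2 + ⋯ + 1/n`. -/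
noncomputable def H (n : ℕ) : ℝ := ∑ m ∈ Finset.Icc 1 n, (1 : ℝ) / m

end RatDef

/-!
Write `f = 1 + t + ⋯ + t ^ n` and let `A` be the averaging operator `(A h) t = ∫₀¹ h (t x) dx`,
which acts on monomials by `t ^ a ↦ t ^ a / (a + 1)`. Integrating the variables block by block,
`T n k r` is the value at `1` of `A ^ k₁ f A ^ k₂ f ⋯ A ^ k_r f`. Everything is read off the weights
`wt n k r a`, the value at `1` of `A ^ k₁ f ⋯ A ^ k_r f t ^ a`: they are positive, decreasing in `a`,
satisfy a finite recursion (`step`), and `T n k r = wt n k r 0` (`T_eq_wt`).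

A power series `h = ∑ h a t ^ a` with nonnegative coefficients, `h 0 = 1` and `f · h ≤ A ^ (-p) h`
coefficientwise bounds `eta n k` from above by `pairing h (wt n k s) = ∑ wt n k s a * h a`, for every
`s`, whenever all entries of `k` are at least `p` (`wt_zero_le_pairing`).

* For `p = 1` the series of `g = exp (t + ⋯ + t ^ n / n)` satisfies `A (f g) = g` exactly. Hence the
  pairing of `g` with the weights of `k₁, …, k_r` is the value of `eta` at `(k₁, …, k_r, 1, 1, …)`,
  and for `r = 0` it is `g 1 = exp (H n)`. As `f ≤ g`, strictly at `1`, the intervals between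
  `wt n k r 0` and this pairing belonging to consecutive values of the last entry overlap, and the
  greedy algorithm (`exists_step`) reaches every point of `(1, exp (H n)]` by a sequence that is not
  terminating.
* For `p = 2` an explicit series `e` (`domCoeff`) is available. The coefficients of `f - A ^ (-1) e`
  change sign only once and have a positive sum, which separates cylinders over sequences with
  entries at least `2` by a multiple of `2 ^ (-(k₁ + ⋯ + k_r))` (`add_le_eta_of_lt`). This gives the
  order statement. Another explicit series (`decayCoeff`) shows that the diameters of these
  cylinders are at most of the same size (`eta_le_add`).

The set `eta n '' THatGe 2` therefore looks like the set of sums `∑ 2 ^ (-(k₁ + ⋯ + k_j))`. Let `q` be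
the inverse golden ratio, so that `∑_{k ≥ 2} q ^ k = 1`, and `q = 2 ^ (-s)` for the asserted dimension
`s`. Covering by cylinders bounds the `s`-dimensional Hausdorff measure (`dimH_le_goldenDim`). For
the lower bound, `eta n k ↦ ∑ q ^ (k₁ + ⋯ + k_j)` is `s`-Hölder, and its image contains the interval
`(0, q]` since every number there has a greedy expansion (`goldenDim_le_dimH`).
-/

namespace RatDef

/-! ### The weights of a sequence and the integral as a finite sum -/

/-- One step of the recursion on weights: if `v a` is a positive linear functional evaluated at
the monomial `t ^ a`, then `step n j v a` is its value at `A ^ j (f · t ^ a)`, where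
`f = 1 + t + ⋯ + t ^ n` and `A` is the averaging operator `t ^ a ↦ t ^ a / (a + 1)`. -/
noncomputable def step (n j : ℕ) (v : ℕ → ℝ) (a : ℕ) : ℝ :=
  ∑ m ∈ Finset.range (n + 1), v (a + m) / ((a + m : ℕ) + 1 : ℝ) ^ j

/-- The weights of the first `r` entries of `k`: `wt n k r a` is the value at `1` of
`A ^ k₁ f A ^ k₂ f ⋯ A ^ k_r f t ^ a`, in the notation of `step`. In particular
`T n k r = wt n k r 0`. -/
noncomputable def wt (n : ℕ) (k : ℕ → ℕ) : ℕ → ℕ → ℝ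
  | 0 => fun _ => 1
  | r + 1 => step n (k r) (wt n k r)

lemma step_zero_eq (n j : ℕ) (v : ℕ → ℝ) :
    step n j v 0 = ∑ m ∈ Finset.range (n + 1), v m / (m + 1 : ℝ) ^ j := by
  simp [step]

lemma wt_congr {n : ℕ} {k l : ℕ → ℕ} {r : ℕ} (h : ∀ i < r, k i = l i) :
    wt n k r = wt n l r := by
  induction r with
  | zero => rfl
  | succ r ih =>
    rw [wt, wt, ih fun i hi => h i (by omega), h r (by omega)]

lemma step_nonneg {n j : ℕ} {v : ℕ → ℝ} (hv : ∀ a, 0 ≤ v a) (a : ℕ) : 0 ≤ step n j v a :=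
  Finset.sum_nonneg fun m _ => div_nonneg (hv _) (by positivity)

lemma div_pow_antitone {j : ℕ} {v : ℕ → ℝ} (hv : ∀ a, 0 ≤ v a) (hv' : Antitone v) :
    Antitone fun a : ℕ => v a / (a + 1 : ℝ) ^ j := by
  intro a b hab
  have : (a : ℝ) ≤ b := by exact_mod_cast hab
  have := hv a
  exact div_le_div₀ (hv a) (hv' hab) (by positivity) (by gcongr)

lemma step_antitone {n j : ℕ} {v : ℕ → ℝ} (hv : ∀ a, 0 ≤ v a) (hv' : Antitone v) :
    Antitone (step n j v) := by
  intro a b hab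
  refine Finset.sum_le_sum fun m _ => ?_
  exact div_pow_antitone (j := j) hv hv' (by omega : a + m ≤ b + m)

lemma step_mono {n j : ℕ} {v w : ℕ → ℝ} (h : ∀ a, v a ≤ w a) (a : ℕ) :
    step n j v a ≤ step n j w a := by
  refine Finset.sum_le_sum fun m _ => ?_
  have := h (a + m)
  gcongr

lemma step_le_step {n i j : ℕ} (hij : i ≤ j) {v : ℕ → ℝ} (hv : ∀ a, 0 ≤ v a) (a : ℕ) :
    step n j v a ≤ step n i v a := by
  refine Finset.sum_le_sum fun m _ => ?_
  have := hv (a + m)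
  have h1 : (1 : ℝ) ≤ ((a + m : ℕ) + 1 : ℝ) := by
    have : (0 : ℝ) ≤ (a + m : ℕ) := by positivity
    linarith
  gcongr

lemma div_le_step {n j : ℕ} {v : ℕ → ℝ} (hv : ∀ a, 0 ≤ v a) (a : ℕ) :
    v a / (a + 1 : ℝ) ^ j ≤ step n j v a := by
  have := Finset.single_le_sum (f := fun m => v (a + m) / ((a + m : ℕ) + 1 : ℝ) ^ j)
    (s := Finset.range (n + 1)) (fun m _ => div_nonneg (hv _) (by positivity))
    (Finset.mem_range.2 (Nat.succ_pos n))
  simpa [step] using this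

lemma step_zero_ge {n j : ℕ} (hn : 1 ≤ n) {v : ℕ → ℝ} (hv : ∀ a, 0 ≤ v a) :
    v 0 + v 1 / 2 ^ j ≤ step n j v 0 := by
  rw [step_zero_eq]
  have := Finset.sum_le_sum_of_subset_of_nonneg
    (f := fun m : ℕ => v m / (m + 1 : ℝ) ^ j)
    (Finset.range_mono (by omega : 2 ≤ n + 1))
    (fun m _ _ => div_nonneg (hv _) (by positivity))
  refine le_trans (le_of_eq ?_) this
  simp [Finset.sum_range_succ]
  norm_num

lemma wt_nonneg (n : ℕ) (k : ℕ → ℕ) (r a : ℕ) : 0 ≤ wt n k r a := by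
  induction r generalizing a with
  | zero => simp [wt]
  | succ r ih => exact step_nonneg ih a

lemma wt_antitone (n : ℕ) (k : ℕ → ℕ) (r : ℕ) : Antitone (wt n k r) := by
  induction r with
  | zero => intro a b _; simp [wt]
  | succ r ih => exact step_antitone (wt_nonneg n k r) ih

lemma wt_zero_monotone (n : ℕ) (k : ℕ → ℕ) : Monotone fun r => wt n k r 0 :=
  monotone_nat_of_le_succ fun r => by
    simpa [wt] using div_le_step (n := n) (j := k r) (wt_nonneg n k r) 0

lemma wt_le_wt_one (n : ℕ) {k : ℕ → ℕ} (hk : ∀ i, 1 ≤ k i) (r a : ℕ) :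
    wt n k r a ≤ wt n (fun _ => 1) r a := by
  induction r generalizing a with
  | zero => simp [wt]
  | succ r ih =>
    exact (step_le_step (hk r) (wt_nonneg n k r) a).trans (step_mono ih a)

lemma weight_succ (k : ℕ → ℕ) (r : ℕ) : weight k (r + 1) = weight k r + k r := by
  simp [weight, Finset.sum_range_succ]

lemma le_wt_one (n : ℕ) (k : ℕ → ℕ) (r : ℕ) : (1 / 2 : ℝ) ^ weight k r ≤ wt n k r 1 := by
  induction r with
  | zero => simp [wt, weight]
  | succ r ih =>
    refine le_trans ?_ (div_le_step (n := n) (j := k r) (wt_nonneg n k r) 1)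
    have h2 : ((1 : ℕ) + 1 : ℝ) = 2 := by norm_num
    rw [weight_succ, pow_add, one_div_pow 2 (k r), h2, mul_one_div]
    gcongr

lemma integral_cube_prod_pow (N : ℕ) (e : ℕ → ℕ) :
    ∫ x in (Set.univ.pi fun _ => Set.Icc 0 1 : Set (Fin N → ℝ)), ∏ i, x i ^ e i
      = ∏ i ∈ Finset.range N, (1 / (e i + 1) : ℝ) := by
  rw [volume_pi, Measure.restrict_pi_pi,
    integral_fintype_prod_eq_prod (fun (i : Fin N) (x : ℝ) => x ^ e i), Finset.prod_range]
  refine Finset.prod_congr rfl fun i _ => ?_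
  rw [integral_Icc_eq_integral_Ioc, ← intervalIntegral.integral_of_le zero_le_one, integral_pow]
  simp

lemma prod_initial_pow {N K : ℕ} (x : Fin N → ℝ) (m : ℕ) :
    (∏ i with Fin.val i < K, x i) ^ m = ∏ i, x i ^ (if i.val < K then m else 0) := by
  rw [← Finset.prod_pow, Finset.prod_filter]
  refine Finset.prod_congr rfl fun i _ => ?_
  split_ifs <;> simp

/-- Expanding the factors of the integrand from the last one on, every monomial that occurs has
an exponent that is constant on the variables of the blocks not yet expanded; the blocks already
expanded contribute only through their exponents. -/
lemma integral_eq_wt_mul (n : ℕ) (k : ℕ → ℕ) (N r a : ℕ) (hr : weight k r ≤ N) (e : ℕ → ℕ)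
    (he : ∀ i < weight k r, e i = a) :
    ∫ x in (Set.univ.pi fun _ => Set.Icc 0 1 : Set (Fin N → ℝ)),
      (∏ j ∈ Finset.Icc 1 r, ∑ m ∈ Finset.range (n + 1),
        (∏ i with Fin.val i < weight k j, x i) ^ m) * ∏ i, x i ^ e i
      = wt n k r a * ∏ i ∈ Finset.Ico (weight k r) N, (1 / (e i + 1) : ℝ) := by
  induction r generalizing a e with
  | zero =>
    simp only [Finset.Icc_eq_empty_of_lt zero_lt_one, Finset.prod_empty, one_mul]
    rw [integral_cube_prod_pow]
    simp [wt, weight]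
  | succ r ih =>
    have hw := weight_succ k r
    have hexp : ∀ x : Fin N → ℝ,
        (∏ j ∈ Finset.Icc 1 (r + 1), ∑ m ∈ Finset.range (n + 1),
          (∏ i with Fin.val i < weight k j, x i) ^ m) * ∏ i, x i ^ e i
        = ∑ m ∈ Finset.range (n + 1), (∏ j ∈ Finset.Icc 1 r, ∑ m ∈ Finset.range (n + 1),
          (∏ i with Fin.val i < weight k j, x i) ^ m) *
            ∏ i, x i ^ ((if i.val < weight k (r + 1) then m else 0) + e i) := by
      intro x
      rw [Finset.prod_Icc_succ_top (by omega), mul_assoc, Finset.sum_mul, Finset.mul_sum]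
      refine Finset.sum_congr rfl fun m _ => ?_
      rw [prod_initial_pow, ← Finset.prod_mul_distrib]
      simp only [pow_add]
    simp only [hexp]
    rw [integral_finsetSum]
    · rw [wt, step, Finset.sum_mul]
      refine Finset.sum_congr rfl fun m _ => ?_
      rw [ih (a + m) (by omega) (fun i => (if i < weight k (r + 1) then m else 0) + e i)
        (fun i hi => by
          rw [he i (by omega), if_pos (by omega), add_comm])]
      rw [← Finset.prod_Ico_consecutive _ (by omega : weight k r ≤ weight k (r + 1)) hr, ← mul_assoc]
      congr 1
      · rw [div_eq_mul_inv]
        congr 1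
        rw [Finset.prod_congr rfl (g := fun _ => (1 / ((a + m : ℕ) + 1) : ℝ))]
        · rw [Finset.prod_const, Nat.card_Ico, hw, Nat.add_sub_cancel_left]
          simp
        · intro i hi
          rw [Finset.mem_Ico] at hi
          rw [he i hi.2, if_pos hi.2, add_comm m a]
      · refine Finset.prod_congr rfl fun i hi => ?_
        rw [Finset.mem_Ico] at hi
        rw [if_neg (by omega), zero_add]
    · intro m _
      refine ContinuousOn.integrableOn_compact (isCompact_univ_pi fun _ => isCompact_Icc) ?_
      exact Continuous.continuousOn (by fun_prop)

lemma T_eq_wt (n : ℕ) (k : ℕ → ℕ) (r : ℕ) : T n k r = wt n k r 0 := by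
  have := integral_eq_wt_mul n k (weight k r) r 0 le_rfl (fun _ => 0) (fun _ _ => rfl)
  simpa [T] using this

/-! ### Pairing weights with power series -/

/-- The coefficients of the product of `1 + t + ⋯ + t ^ n` with the power series `∑ h a t ^ a`. -/
def conv (n : ℕ) (h : ℕ → ℝ) (b : ℕ) : ℝ :=
  ∑ m ∈ Finset.range (n + 1), if m ≤ b then h (b - m) else 0

/-- The value of the functional with weights `v` at the power series `∑ h a t ^ a`. -/
noncomputable def pairing (h v : ℕ → ℝ) : ℝ := ∑' a, v a * h a

lemma conv_nonneg {n : ℕ} {h : ℕ → ℝ} (hh : ∀ a, 0 ≤ h a) (b : ℕ) : 0 ≤ conv n h b :=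
  Finset.sum_nonneg fun m _ => by split_ifs <;> simp [hh]

lemma summable_mul_of_antitone {h v : ℕ → ℝ} (hs : Summable h) (hh : ∀ a, 0 ≤ h a)
    (hv : ∀ a, 0 ≤ v a) (hv' : Antitone v) : Summable fun a => v a * h a :=
  Summable.of_nonneg_of_le (fun a => mul_nonneg (hv a) (hh a))
    (fun a => mul_le_mul_of_nonneg_right (hv' (Nat.zero_le a)) (hh a)) (hs.mul_left (v 0))

lemma le_pairing {h v : ℕ → ℝ} (hs : Summable h) (hh : ∀ a, 0 ≤ h a)
    (hv : ∀ a, 0 ≤ v a) (hv' : Antitone v) (a : ℕ) : v a * h a ≤ pairing h v :=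
  (summable_mul_of_antitone hs hh hv hv').le_tsum a fun b _ => mul_nonneg (hv b) (hh b)

/-- The transpose of `step n j` is `h ↦ A ^ j (f · h)`. -/
lemma hasSum_step {n j : ℕ} {h v : ℕ → ℝ} (hs : Summable h) (hh : ∀ a, 0 ≤ h a)
    (hv : ∀ a, 0 ≤ v a) (hv' : Antitone v) :
    HasSum (fun b : ℕ => v b / (b + 1 : ℝ) ^ j * conv n h b) (pairing h (step n j v)) := by
  have hd := div_pow_antitone (j := j) hv hv'
  have hd0 : ∀ a : ℕ, 0 ≤ v a / (a + 1 : ℝ) ^ j := fun a => div_nonneg (hv a) (by positivity)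
  have hsum : ∀ m : ℕ, Summable fun a => v (a + m) / ((a + m : ℕ) + 1 : ℝ) ^ j * h a := fun m =>
    summable_mul_of_antitone hs hh (fun a => hd0 (a + m))
      (fun a b hab => hd (Nat.add_le_add_right hab m))
  have e1 : pairing h (step n j v) = ∑ m ∈ Finset.range (n + 1),
      ∑' a, v (a + m) / ((a + m : ℕ) + 1 : ℝ) ^ j * h a := by
    rw [pairing, ← Summable.tsum_finsetSum fun m _ => hsum m]
    simp only [step, Finset.sum_mul]
  rw [e1]
  simp only [conv, Finset.mul_sum]
  refine hasSum_sum fun m _ => ?_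
  rw [← (add_left_injective m).hasSum_iff]
  · convert! (hsum m).hasSum using 2 with a
    simp
  · intro b hb
    rw [if_neg, mul_zero]
    exact fun hmb => hb ⟨b - m, Nat.sub_add_cancel hmb⟩

lemma pairing_mono {h v w : ℕ → ℝ} (hs : Summable h) (hh : ∀ a, 0 ≤ h a)
    (hv : ∀ a, 0 ≤ v a) (hw : ∀ a, 0 ≤ w a) (hv' : Antitone v) (hw' : Antitone w)
    (hvw : ∀ a, v a ≤ w a) : pairing h v ≤ pairing h w :=
  (summable_mul_of_antitone hs hh hv hv').tsum_le_tsum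
    (fun a => mul_le_mul_of_nonneg_right (hvw a) (hh a)) (summable_mul_of_antitone hs hh hw hw')

lemma mul_pairing_step_le {n j : ℕ} {c : ℝ} {h v : ℕ → ℝ} (hs : Summable h)
    (hh : ∀ a, 0 ≤ h a) (hv : ∀ a, 0 ≤ v a) (hv' : Antitone v)
    (hc : ∀ b : ℕ, c * conv n h b ≤ (b + 1 : ℝ) ^ j * h b) :
    c * pairing h (step n j v) ≤ pairing h v := by
  refine hasSum_le (fun b => ?_) ((hasSum_step hs hh hv hv').mul_left c)
    (summable_mul_of_antitone hs hh hv hv').hasSum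
  calc c * (v b / (b + 1 : ℝ) ^ j * conv n h b) = v b / (b + 1 : ℝ) ^ j * (c * conv n h b) := by ring
    _ ≤ v b / (b + 1 : ℝ) ^ j * ((b + 1 : ℝ) ^ j * h b) :=
      mul_le_mul_of_nonneg_left (hc b) (div_nonneg (hv b) (by positivity))
    _ = v b * h b := by field_simp

lemma pairing_le_add {h v : ℕ → ℝ} (hs : Summable h) (hh : ∀ a, 0 ≤ h a) (h0 : h 0 = 1)
    (hv : ∀ a, 0 ≤ v a) (hv' : Antitone v) : pairing h v ≤ v 0 + v 1 * ∑' a, h a := by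
  have hs1 : Summable fun a => h (a + 1) := (summable_nat_add_iff 1).2 hs
  rw [pairing, (summable_mul_of_antitone hs hh hv hv').tsum_eq_zero_add, h0, mul_one,
    hs.tsum_eq_zero_add, mul_add, ← tsum_mul_left]
  have : ∑' a, v (a + 1) * h (a + 1) ≤ ∑' a, v 1 * h (a + 1) :=
    ((summable_nat_add_iff 1).2 (summable_mul_of_antitone hs hh hv hv')).tsum_le_tsum
      (fun a => mul_le_mul_of_nonneg_right (hv' (by omega)) (hh _)) (hs1.mul_left _)
  have := mul_nonneg (hv 1) (hh 0)
  linarith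

/-- If `f · h ≤ A⁻¹ h` coefficientwise, pairing with `h` gives upper bounds for all later weights. -/
lemma pairing_wt_antitone {n p : ℕ} {h : ℕ → ℝ} (hs : Summable h) (hh : ∀ a, 0 ≤ h a)
    (hc : ∀ b : ℕ, conv n h b ≤ (b + 1 : ℝ) ^ p * h b) {k : ℕ → ℕ} (hk : ∀ i, p ≤ k i) :
    Antitone fun r => pairing h (wt n k r) := by
  refine antitone_nat_of_succ_le fun r => ?_
  have := mul_pairing_step_le (c := 1) (j := k r) hs hh (wt_nonneg n k r) (wt_antitone n k r)
    (fun b => by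
      rw [one_mul]
      refine (hc b).trans (mul_le_mul_of_nonneg_right ?_ (hh b))
      exact pow_le_pow_right₀ (by linarith [(Nat.cast_nonneg b : (0 : ℝ) ≤ b)]) (hk r))
  rwa [one_mul] at this

lemma wt_zero_le_pairing {n p : ℕ} {h : ℕ → ℝ} (hs : Summable h) (hh : ∀ a, 0 ≤ h a)
    (h0 : h 0 = 1) (hc : ∀ b : ℕ, conv n h b ≤ (b + 1 : ℝ) ^ p * h b) {k : ℕ → ℕ}
    (hk : ∀ i, p ≤ k i) (r s : ℕ) : wt n k r 0 ≤ pairing h (wt n k s) := by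
  have key : ∀ r, wt n k r 0 ≤ pairing h (wt n k r) := fun r => by
    simpa [h0] using le_pairing hs hh (wt_nonneg n k r) (wt_antitone n k r) 0
  calc wt n k r 0 ≤ wt n k (max r s) 0 := wt_zero_monotone n k (le_max_left _ _)
    _ ≤ pairing h (wt n k (max r s)) := key _
    _ ≤ pairing h (wt n k s) := pairing_wt_antitone hs hh hc hk (le_max_right _ _)

/-! ### The power series of `exp (t + t ^ 2 / 2 + ⋯ + t ^ n / n)` -/

/-- The power series of `exp (t ^ m / m)`. -/
noncomputable def expMonomial (m : ℕ) : PowerSeries ℝ :=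
  PowerSeries.mk fun a => if m ∣ a then (1 / m : ℝ) ^ (a / m) / (a / m).factorial else 0

/-- The power series of `exp (t + t ^ 2 / 2 + ⋯ + t ^ n / n)`. -/
noncomputable def expSeries (n : ℕ) : PowerSeries ℝ :=
  ∏ m ∈ Finset.Icc 1 n, expMonomial m

/-- The coefficients of `exp (t + t ^ 2 / 2 + ⋯ + t ^ n / n)`. -/
noncomputable def expCoeff (n a : ℕ) : ℝ := PowerSeries.coeff a (expSeries n)

lemma hasSum_coeff_mul {φ ψ : PowerSeries ℝ} {s t : ℝ} (hs : HasSum (fun a => φ.coeff a) s)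
    (ht : HasSum (fun a => ψ.coeff a) t) : HasSum (fun a => (φ * ψ).coeff a) (s * t) := by
  have h1 : Summable fun a => ‖φ.coeff a‖ := hs.summable.norm
  have h2 : Summable fun a => ‖ψ.coeff a‖ := ht.summable.norm
  have h := tsum_mul_tsum_eq_tsum_sum_antidiagonal_of_summable_norm h1 h2
  rw [hs.tsum_eq, ht.tsum_eq] at h
  simp only [PowerSeries.coeff_mul]
  rw [h]
  exact (summable_norm_sum_mul_antidiagonal_of_summable_norm h1 h2).of_norm.hasSum

lemma expMonomial_nonneg (m a : ℕ) : 0 ≤ (expMonomial m).coeff a := by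
  rw [expMonomial, PowerSeries.coeff_mk]
  split_ifs <;> positivity

lemma hasSum_expMonomial {m : ℕ} (hm : 1 ≤ m) :
    HasSum (fun a => (expMonomial m).coeff a) (Real.exp (1 / m)) := by
  have hinj : Function.Injective fun j : ℕ => m * j :=
    fun i j h => Nat.eq_of_mul_eq_mul_left hm h
  rw [← hinj.hasSum_iff]
  · rw [Real.exp_eq_exp_ℝ]
    convert! NormedSpace.expSeries_div_hasSum_exp (1 / m : ℝ) using 2 with j
    simp [expMonomial, Nat.mul_div_cancel_left j hm]
  · intro b hb
    rw [expMonomial, PowerSeries.coeff_mk, if_neg]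
    rintro ⟨c, rfl⟩
    exact hb ⟨c, rfl⟩

lemma X_mul_derivative_expMonomial {m : ℕ} (hm : 1 ≤ m) :
    PowerSeries.X * PowerSeries.derivative ℝ (expMonomial m)
      = PowerSeries.X ^ m * expMonomial m := by
  ext a
  rw [PowerSeries.coeff_X_pow_mul']
  rcases a with _ | a
  · simp [show ¬ m ≤ 0 by omega]
  · rw [PowerSeries.coeff_succ_X_mul, PowerSeries.coeff_derivative, expMonomial,
      PowerSeries.coeff_mk, PowerSeries.coeff_mk]
    by_cases hma : m ∣ a + 1
    · obtain ⟨c, hc⟩ := hma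
      rcases c with _ | c
      · omega
      · have h1 : m ≤ a + 1 := by rw [hc]; exact Nat.le_mul_of_pos_right m (by omega)
        have h2 : a + 1 - m = m * c := by rw [hc, Nat.mul_succ]; omega
        have h3 : (a + 1 : ℝ) = m * (c + 1) := by exact_mod_cast hc
        have hm0 : (m : ℝ) ≠ 0 := by positivity
        rw [if_pos h1, h2, hc, if_pos (Dvd.intro _ rfl), if_pos (Dvd.intro _ rfl),
          Nat.mul_div_cancel_left _ hm, Nat.mul_div_cancel_left _ hm, h3, Nat.factorial_succ]
        push_cast
        rw [pow_succ]
        field_simp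
    · rw [if_neg hma, zero_mul]
      split_ifs with h1 h2
      · exact absurd ((Nat.dvd_sub_iff_left h1 dvd_rfl).1 h2) hma
      · rfl
      · rfl

lemma X_mul_derivative_expSeries (n : ℕ) :
    PowerSeries.X * PowerSeries.derivative ℝ (expSeries n)
      = (∑ m ∈ Finset.Icc 1 n, PowerSeries.X ^ m) * expSeries n := by
  induction n with
  | zero => simp [expSeries]
  | succ n ih =>
    have hE := X_mul_derivative_expMonomial (m := n + 1) (by omega)
    rw [expSeries, Finset.prod_Icc_succ_top (by omega), Finset.sum_Icc_succ_top (by omega)]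
    change _ * PowerSeries.derivative ℝ (expSeries n * expMonomial (n + 1)) =
      _ * (expSeries n * expMonomial (n + 1))
    rw [Derivation.leibniz, smul_eq_mul, smul_eq_mul]
    linear_combination expSeries n * hE + expMonomial (n + 1) * ih

lemma expCoeff_nonneg_and_hasSum (n : ℕ) :
    (∀ a, 0 ≤ expCoeff n a) ∧ HasSum (expCoeff n) (Real.exp (H n)) := by
  induction n with
  | zero =>
    constructor
    · intro a
      simp only [expCoeff, expSeries, Finset.Icc_eq_empty_of_lt zero_lt_one, Finset.prod_empty,
        PowerSeries.coeff_one]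
      split_ifs <;> norm_num
    · have := hasSum_ite_eq (0 : ℕ) (1 : ℝ)
      have h0 : expCoeff 0 = fun a => if a = 0 then (1 : ℝ) else 0 := by
        ext a
        simp [expCoeff, expSeries, PowerSeries.coeff_one]
      rw [h0]
      simpa [H] using this
  | succ n ih =>
    have hmul : expSeries (n + 1) = expSeries n * expMonomial (n + 1) := by
      rw [expSeries, Finset.prod_Icc_succ_top (by omega)]; rfl
    have hH : H (n + 1) = H n + 1 / (n + 1 : ℕ) := by
      rw [H, Finset.sum_Icc_succ_top (by omega)]; rfl
    constructor
    · intro a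
      rw [expCoeff, hmul, PowerSeries.coeff_mul]
      exact Finset.sum_nonneg fun p _ => mul_nonneg (ih.1 _) (expMonomial_nonneg _ _)
    · rw [hH, Real.exp_add]
      have := hasSum_coeff_mul ih.2 (hasSum_expMonomial (m := n + 1) (by omega))
      rw [← hmul] at this
      exact this

lemma expCoeff_nonneg (n a : ℕ) : 0 ≤ expCoeff n a := (expCoeff_nonneg_and_hasSum n).1 a

lemma hasSum_expCoeff (n : ℕ) : HasSum (expCoeff n) (Real.exp (H n)) :=
  (expCoeff_nonneg_and_hasSum n).2

lemma expCoeff_zero (n : ℕ) : expCoeff n 0 = 1 := by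
  simp [expCoeff, expSeries, expMonomial, map_prod]

/-- The coefficient form of `t g' = (f - 1) g`, where `f = 1 + t + ⋯ + t ^ n` and
`g = exp (t + ⋯ + t ^ n / n)`. -/
lemma conv_expCoeff (n b : ℕ) : conv n (expCoeff n) b = (b + 1) * expCoeff n b := by
  have h := congrArg (PowerSeries.coeff b) (X_mul_derivative_expSeries n)
  have h1 : PowerSeries.coeff b (PowerSeries.X * PowerSeries.derivative ℝ (expSeries n))
      = b * expCoeff n b := by
    rcases b with _ | b
    · simp
    · rw [PowerSeries.coeff_succ_X_mul, PowerSeries.coeff_derivative, expCoeff]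
      push_cast
      ring
  rw [h1, Finset.sum_mul, map_sum] at h
  simp only [PowerSeries.coeff_X_pow_mul'] at h
  rw [conv, Finset.range_eq_Ico, Finset.sum_eq_sum_Ico_succ_bot (by omega)]
  simp only [zero_le, if_true, Nat.sub_zero, zero_add]
  rw [add_mul, h, one_mul, add_comm]
  rfl

lemma expCoeff_eq_one {n a : ℕ} (ha : a ≤ n) : expCoeff n a = 1 := by
  induction a using Nat.strong_induction_on with
  | _ a ih =>
    rcases a with _ | a
    · exact expCoeff_zero n
    · have h := conv_expCoeff n (a + 1)
      have h2 : conv n (expCoeff n) (a + 1) = expCoeff n (a + 1) + (a + 1) := by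
        rw [conv, Finset.sum_ite, Finset.sum_const_zero, add_zero]
        have : (Finset.range (n + 1)).filter (· ≤ a + 1) = Finset.range (a + 1 + 1) := by
          ext; simp; omega
        rw [this, Finset.sum_range_succ', Nat.sub_zero, add_comm]
        congr 1
        rw [Finset.sum_congr rfl (g := fun _ => (1 : ℝ))]
        · simp
        · intro m hm
          rw [Finset.mem_range] at hm
          exact ih _ (by omega) (by omega)
      rw [h2] at h
      push_cast at h
      have h3 : (0 : ℝ) < a + 1 := by positivity
      have : (a + 1 : ℝ) * expCoeff n (a + 1) = (a + 1) * 1 := by linarith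
      exact mul_left_cancel₀ h3.ne' this

lemma expCoeff_succ_pos {n : ℕ} (hn : 1 ≤ n) : 0 < expCoeff n (n + 1) := by
  have h := conv_expCoeff n (n + 1)
  have h2 := Finset.single_le_sum
    (f := fun m => if m ≤ n + 1 then expCoeff n (n + 1 - m) else 0)
    (s := (Finset.range (n + 1)))
    (fun m _ => by split_ifs <;> simp [expCoeff_nonneg])
    (Finset.mem_range.2 (by omega : 1 < n + 1))
  rw [← conv, h, if_pos (by omega), Nat.add_sub_cancel, expCoeff_eq_one le_rfl] at h2
  by_contra! h3
  have := mul_nonpos_of_nonneg_of_nonpos (by positivity : (0 : ℝ) ≤ ((n + 1 : ℕ) + 1 : ℝ)) h3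
  linarith

/-! ### Convergence, and the values of `eta` -/

lemma step_pos {n j : ℕ} {v : ℕ → ℝ} (hv : ∀ a, 0 < v a) (a : ℕ) : 0 < step n j v a :=
  (div_pos (hv a) (by positivity)).trans_le (div_le_step (fun a => (hv a).le) a)

lemma wt_pos (n : ℕ) (k : ℕ → ℕ) (r a : ℕ) : 0 < wt n k r a := by
  induction r generalizing a with
  | zero => simp [wt]
  | succ r ih => exact step_pos ih a

lemma conv_expCoeff_le (n b : ℕ) : conv n (expCoeff n) b ≤ (b + 1 : ℝ) ^ 1 * expCoeff n b := by
  rw [conv_expCoeff, pow_one]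

lemma wt_zero_le_pairing_expCoeff (n : ℕ) {k : ℕ → ℕ} (hk : k ∈ THat) (r s : ℕ) :
    wt n k r 0 ≤ pairing (expCoeff n) (wt n k s) :=
  wt_zero_le_pairing (hasSum_expCoeff n).summable (expCoeff_nonneg n) (expCoeff_zero n)
    (conv_expCoeff_le n) hk r s

lemma pairing_expCoeff_one (n : ℕ) (k : ℕ → ℕ) :
    pairing (expCoeff n) (wt n k 0) = Real.exp (H n) := by
  simp [pairing, wt, (hasSum_expCoeff n).tsum_eq]

lemma hasSum_step_expCoeff {n j : ℕ} {v : ℕ → ℝ} (hv : ∀ a, 0 ≤ v a) (hv' : Antitone v) :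
    HasSum (fun b : ℕ => v b / (b + 1 : ℝ) ^ j * expCoeff n b)
      (pairing (expCoeff n) (step n (j + 1) v)) := by
  convert! hasSum_step (n := n) (j := j + 1) (hasSum_expCoeff n).summable (expCoeff_nonneg n) hv hv'
    using 2 with b
  rw [conv_expCoeff, pow_succ]
  field_simp

lemma pairing_expCoeff_step_one {n : ℕ} {v : ℕ → ℝ} (hv : ∀ a, 0 ≤ v a) (hv' : Antitone v) :
    pairing (expCoeff n) (step n 1 v) = pairing (expCoeff n) v := by
  rw [← (hasSum_step_expCoeff (j := 0) hv hv').tsum_eq]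
  simp [pairing]

lemma pairing_expCoeff_step_lt {n j : ℕ} (hn : 1 ≤ n) (hj : 2 ≤ j) {v : ℕ → ℝ}
    (hv : ∀ a, 0 < v a) (hv' : Antitone v) :
    pairing (expCoeff n) (step n j v) < pairing (expCoeff n) v := by
  obtain ⟨j, rfl⟩ : ∃ i, j = i + 1 := ⟨j - 1, by omega⟩
  refine hasSum_lt (i := 1) (fun b => ?_) ?_ (hasSum_step_expCoeff (fun a => (hv a).le) hv')
    (summable_mul_of_antitone (hasSum_expCoeff n).summable (expCoeff_nonneg n)
      (fun a => (hv a).le) hv').hasSum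
  · refine mul_le_mul_of_nonneg_right (div_le_self (hv b).le (one_le_pow₀ ?_)) (expCoeff_nonneg n b)
    linarith [(Nat.cast_nonneg b : (0 : ℝ) ≤ b)]
  · rw [expCoeff_eq_one hn, mul_one, mul_one]
    refine div_lt_self (hv 1) (one_lt_pow₀ (by norm_num) (by omega))

/-- Since `1 + t + ⋯ + t ^ n ≤ exp (t + ⋯ + t ^ n / n)`, strictly in degree `n + 1`, the intervals of values of
consecutive subcylinders overlap. -/
lemma step_lt_pairing_step_succ {n j : ℕ} (hn : 1 ≤ n) {v : ℕ → ℝ}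
    (hv : ∀ a, 0 < v a) (hv' : Antitone v) :
    step n j v 0 < pairing (expCoeff n) (step n (j + 1) v) := by
  have h := sum_le_hasSum (Finset.range (n + 2))
    (fun b _ => mul_nonneg (div_nonneg (hv b).le (by positivity)) (expCoeff_nonneg n b))
    (hasSum_step_expCoeff (n := n) (j := j) (fun a => (hv a).le) hv')
  refine lt_of_lt_of_le ?_ h
  rw [Finset.sum_range_succ, step_zero_eq]
  have h1 : ∑ m ∈ Finset.range (n + 1), v m / (m + 1 : ℝ) ^ j * expCoeff n m
      = ∑ m ∈ Finset.range (n + 1), v m / (m + 1 : ℝ) ^ j :=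
    Finset.sum_congr rfl fun m hm => by
      rw [expCoeff_eq_one (by rw [Finset.mem_range] at hm; omega), mul_one]
  rw [h1]
  have := mul_pos (div_pos (hv (n + 1)) (by positivity : (0 : ℝ) < ((n + 1 : ℕ) + 1 : ℝ) ^ j))
    (expCoeff_succ_pos hn)
  linarith

lemma tendsto_wt_zero (n : ℕ) {k : ℕ → ℕ} (hk : k ∈ THat) :
    Tendsto (fun r => wt n k r 0) atTop (𝓝 (eta n k)) := by
  have h : Tendsto (fun r => wt n k r 0) atTop (𝓝 (⨆ r, wt n k r 0)) :=
    tendsto_atTop_ciSup (wt_zero_monotone n k)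
      ⟨_, by rintro _ ⟨r, rfl⟩; exact wt_zero_le_pairing_expCoeff n hk r 0⟩
  simp only [eta, T_eq_wt]
  exact tendsto_nhds_limUnder ⟨_, h⟩

lemma wt_zero_le_eta (n : ℕ) {k : ℕ → ℕ} (hk : k ∈ THat) (r : ℕ) : wt n k r 0 ≤ eta n k :=
  (wt_zero_monotone n k).ge_of_tendsto (tendsto_wt_zero n hk) r

lemma eta_le_pairing_expCoeff (n : ℕ) {k : ℕ → ℕ} (hk : k ∈ THat) (s : ℕ) :
    eta n k ≤ pairing (expCoeff n) (wt n k s) :=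
  le_of_tendsto' (tendsto_wt_zero n hk) fun r => wt_zero_le_pairing_expCoeff n hk r s

lemma tendsto_wt_one {n : ℕ} (hn : 1 ≤ n) {k : ℕ → ℕ} (hk : k ∈ THat) :
    Tendsto (fun r => wt n k r 1) atTop (𝓝 0) := by
  -- For `k = (1, 1, …)` the series `∑ wt n k r 1 / 2` telescopes below a convergent sequence.
  have h1 : Tendsto (fun r => 2 * (wt n (fun _ => 1) (r + 1) 0 - wt n (fun _ => 1) r 0))
      atTop (𝓝 0) := by
    have h := tendsto_wt_zero n (k := fun _ => 1) (fun _ => le_rfl)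
    simpa using (((tendsto_add_atTop_iff_nat 1).2 h).sub h).const_mul 2
  refine squeeze_zero (fun r => wt_nonneg n k r 1) (fun r => ?_) h1
  have h2 := step_zero_ge (j := 1) hn (wt_nonneg n (fun _ => 1) r)
  have h3 := wt_le_wt_one n hk r 1
  change _ ≤ wt n (fun _ => 1) (r + 1) 0 at h2
  linarith

lemma tendsto_pairing_expCoeff {n : ℕ} (hn : 1 ≤ n) {k : ℕ → ℕ} (hk : k ∈ THat) :
    Tendsto (fun r => pairing (expCoeff n) (wt n k r)) atTop (𝓝 (eta n k)) := by
  have h : Tendsto (fun r => wt n k r 0 + wt n k r 1 * ∑' a, expCoeff n a) atTop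
      (𝓝 (eta n k)) := by
    simpa using (tendsto_wt_zero n hk).add ((tendsto_wt_one hn hk).mul_const _)
  exact tendsto_of_tendsto_of_tendsto_of_le_of_le (tendsto_wt_zero n hk) h
    (fun r => wt_zero_le_pairing_expCoeff n hk r r)
    (fun r => pairing_le_add (hasSum_expCoeff n).summable (expCoeff_nonneg n) (expCoeff_zero n)
      (wt_nonneg n k r) (wt_antitone n k r))

lemma one_lt_eta {n : ℕ} (hn : 1 ≤ n) {k : ℕ → ℕ} (hk : k ∈ THat) : 1 < eta n k := by
  refine lt_of_lt_of_le ?_ (wt_zero_le_eta n hk 1)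
  refine lt_of_lt_of_le ?_ (step_zero_ge (j := k 0) hn (wt_nonneg n k 0))
  have : (0 : ℝ) < 1 / 2 ^ k 0 := by positivity
  simp only [wt]
  linarith

lemma eta_le_exp (n : ℕ) {k : ℕ → ℕ} (hk : k ∈ THat) : eta n k ≤ Real.exp (H n) :=
  pairing_expCoeff_one n k ▸ eta_le_pairing_expCoeff n hk 0

lemma eta_lt_exp {n : ℕ} (hn : 1 ≤ n) {k : ℕ → ℕ} (hk : k ∈ THat) {s : ℕ} (hs : 2 ≤ k s) :
    eta n k < Real.exp (H n) :=
  calc eta n k ≤ pairing (expCoeff n) (wt n k (s + 1)) := eta_le_pairing_expCoeff n hk _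
    _ < pairing (expCoeff n) (wt n k s) :=
      pairing_expCoeff_step_lt hn hs (wt_pos n k s) (wt_antitone n k s)
    _ ≤ pairing (expCoeff n) (wt n k 0) :=
      pairing_wt_antitone (hasSum_expCoeff n).summable (expCoeff_nonneg n) (conv_expCoeff_le n) hk
        (Nat.zero_le s)
    _ = Real.exp (H n) := pairing_expCoeff_one n k

/-- Replacing the tail of a sequence by `(1, 1, …)` gives the largest value on a cylinder, namely
the pairing of its weights with `expCoeff n`. -/
lemma eta_eq_pairing_of_tail_one {n : ℕ} (hn : 1 ≤ n) {k : ℕ → ℕ} (hk : k ∈ THat) {s : ℕ}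
    (h1 : ∀ i, s ≤ i → k i = 1) : eta n k = pairing (expCoeff n) (wt n k s) := by
  have hc : ∀ r, pairing (expCoeff n) (wt n k (r + s)) = pairing (expCoeff n) (wt n k s) := by
    intro r
    induction r with
    | zero => simp
    | succ r ih =>
      rw [Nat.add_right_comm, wt, h1 (r + s) (by omega),
        pairing_expCoeff_step_one (wt_nonneg n k _) (wt_antitone n k _), ih]
  have h := (tendsto_add_atTop_iff_nat s).2 (tendsto_pairing_expCoeff hn hk)
  simp only [hc] at h
  exact tendsto_nhds_unique h tendsto_const_nhds

lemma eta_const_one {n : ℕ} (hn : 1 ≤ n) : eta n (fun _ => 1) = Real.exp (H n) := by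
  rw [eta_eq_pairing_of_tail_one hn (k := fun _ => 1) (fun _ => le_rfl) (s := 0) fun _ _ => rfl,
    pairing_expCoeff_one]

/-- Iterating a choice of exponents that preserves `P`. -/
lemma exists_orbit {α : Type*} (f : ℕ → α → α) (P : α → Prop) (Q : ℕ → α → Prop)
    (h : ∀ x, P x → ∃ j, Q j x ∧ P (f j x)) (x₀ : α) (h₀ : P x₀) :
    ∃ (k : ℕ → ℕ) (x : ℕ → α), x 0 = x₀ ∧ (∀ r, x (r + 1) = f (k r) (x r)) ∧
      ∀ r, P (x r) ∧ Q (k r) (x r) := by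
  choose! J hJ using h
  let x : ℕ → α := fun r => Nat.rec x₀ (fun _ y => f (J y) y) r
  have hP : ∀ r, P (x r) := fun r => by
    induction r with
    | zero => exact h₀
    | succ r ih => exact (hJ _ ih).2
  exact ⟨fun r => J (x r), x, rfl, fun r => rfl, fun r => ⟨hP r, (hJ _ (hP r)).1⟩⟩

lemma tendsto_step_zero (n : ℕ) (v : ℕ → ℝ) :
    Tendsto (fun j => step n j v 0) atTop (𝓝 (v 0)) := by
  simp only [step_zero_eq, Finset.sum_range_succ', Nat.cast_zero, zero_add, one_pow, div_one]
  have : Tendsto (fun j => ∑ m ∈ Finset.range n, v (m + 1) / ((m + 1 : ℕ) + 1 : ℝ) ^ j) atTop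
      (𝓝 (∑ m ∈ Finset.range n, 0)) := by
    refine tendsto_finsetSum _ fun m _ => ?_
    refine tendsto_const_nhds.div_atTop (tendsto_pow_atTop_atTop_of_one_lt ?_)
    push_cast
    linarith [(Nat.cast_nonneg m : (0 : ℝ) ≤ m)]
  simpa using this.add_const (v 0)

/-- The greedy algorithm: given `x ≤ pairing (expCoeff n) v` above `v 0`, the smallest exponent `j`
with `step n j v 0 < x` preserves these inequalities, and `x` is not the top of the new interval
unless `j = 1`. -/
lemma exists_step {n : ℕ} (hn : 1 ≤ n) {v : ℕ → ℝ} (hv : ∀ a, 0 < v a) (hv' : Antitone v)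
    {x : ℝ} (h0 : v 0 < x) (h1 : x ≤ pairing (expCoeff n) v) :
    ∃ j, (1 ≤ j ∧ (2 ≤ j → x < pairing (expCoeff n) (step n j v))) ∧
      step n j v 0 < x ∧ x ≤ pairing (expCoeff n) (step n j v) := by
  classical
  have hex : ∃ j, step n (j + 1) v 0 < x :=
    (((tendsto_add_atTop_iff_nat 1).2 (tendsto_step_zero n v)).eventually_lt_const h0).exists
  have hmin := Nat.find_spec hex
  have hlt : ∀ i < Nat.find hex, x ≤ step n (i + 1) v 0 := fun i hi =>
    not_lt.1 (Nat.find_min hex hi)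
  refine ⟨Nat.find hex + 1, ⟨by omega, ?_⟩, hmin, ?_⟩
  · intro h2
    refine (hlt (Nat.find hex - 1) (by omega)).trans_lt ?_
    rw [Nat.sub_add_cancel (by omega)]
    exact step_lt_pairing_step_succ hn hv hv'
  · rcases Nat.eq_zero_or_pos (Nat.find hex) with h | h
    · rwa [h, pairing_expCoeff_step_one (fun a => (hv a).le) hv']
    · refine (hlt (Nat.find hex - 1) (by omega)).trans ?_
      rw [Nat.sub_add_cancel h]
      exact (step_lt_pairing_step_succ hn hv hv').le

lemma exists_eta_eq {n : ℕ} (hn : 1 ≤ n) {x : ℝ} (hx : x ∈ Set.Ioc 1 (Real.exp (H n))) :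
    ∃ k ∈ THat \ THatR, eta n k = x := by
  obtain ⟨k, v, hv0, hvs, hv⟩ := exists_orbit (step n)
    (fun v : ℕ → ℝ => ((∀ a, 0 < v a) ∧ Antitone v) ∧ v 0 < x ∧ x ≤ pairing (expCoeff n) v)
    (fun j v => 1 ≤ j ∧ (2 ≤ j → x < pairing (expCoeff n) (step n j v)))
    (fun v ⟨⟨hp, ha⟩, h0, h1⟩ => by
      obtain ⟨j, hj, h⟩ := exists_step hn hp ha h0 h1
      exact ⟨j, hj, ⟨step_pos hp, step_antitone (fun a => (hp a).le) ha⟩, h⟩)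
    (fun _ => 1) ⟨⟨fun _ => one_pos, antitone_const⟩, hx.1,
      (pairing_expCoeff_one n fun _ => 1).symm ▸ hx.2⟩
  have hwt : ∀ r, v r = wt n k r := fun r => by
    induction r with
    | zero => exact hv0
    | succ r ih => rw [hvs, ih, wt]
  simp only [hwt] at hv
  have hk : k ∈ THat := fun i => (hv i).2.1
  have heta : eta n k = x := le_antisymm
    (le_of_tendsto' (tendsto_wt_zero n hk) fun r => (hv r).1.2.1.le)
    (ge_of_tendsto' (tendsto_pairing_expCoeff hn hk) fun r => (hv r).1.2.2)
  refine ⟨k, ⟨hk, ?_⟩, heta⟩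
  rintro ⟨-, s, hs, h1⟩
  have h2 := (hv s).2.2 hs
  rw [← heta, eta_eq_pairing_of_tail_one hn hk (s := s + 1) fun i hi => h1 i hi] at h2
  exact lt_irrefl _ h2

/-! ### Dominating power series for sequences with entries at least two -/

lemma hasSum_one_div_succ_mul :
    HasSum (fun i : ℕ => 1 / ((i + 1 : ℝ) * (i + 2))) 1 := by
  rw [hasSum_iff_tendsto_nat_of_nonneg fun i => by positivity]
  have h : ∀ N : ℕ, ∑ i ∈ Finset.range N, 1 / ((i + 1 : ℝ) * (i + 2)) = 1 - 1 / (N + 1) := by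
    intro N
    induction N with
    | zero => simp
    | succ N ih =>
      rw [Finset.sum_range_succ, ih]
      push_cast
      field_simp
      ring
  simp only [h]
  simpa using tendsto_one_div_add_atTop_nhds_zero_nat (𝕜 := ℝ) |>.const_sub 1

lemma conv_eq_sum_range (n : ℕ) (h : ℕ → ℝ) (b : ℕ) :
    conv n h b = ∑ m ∈ Finset.range (min n b + 1), h (b - m) := by
  rw [conv, ← Finset.sum_filter]
  congr 1
  ext m
  simp

/-- Coefficients `e a` of a power series with `f · e ≤ A ^ (-2) e` coefficientwise, where
`f = 1 + t + ⋯ + t ^ n`. Up to degree `n` it agrees with the solution `2 / ((a + 1) (a + 2))` of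
the corresponding equation with `f` replaced by `1 / (1 - t)`; in degrees `a > n` (where
`max a n = a`, and `a - n` is not truncated) it is smaller by the factor `n / (a (a - n + 1))`. -/
noncomputable def domCoeff (n a : ℕ) : ℝ :=
  2 / ((a + 1 : ℝ) * (a + 2)) * (n / ((max a n : ℕ) * ((a - n : ℕ) + 1 : ℝ)))

lemma domCoeff_nonneg (n a : ℕ) : 0 ≤ domCoeff n a := by unfold domCoeff; positivity

lemma domCoeff_of_le {n a : ℕ} (hn : 1 ≤ n) (ha : a ≤ n) :
    domCoeff n a = 2 / ((a + 1 : ℝ) * (a + 2)) := by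
  have : (n : ℝ) ≠ 0 := by positivity
  simp [domCoeff, Nat.sub_eq_zero_of_le ha, max_eq_right ha, this]

lemma domCoeff_add (n c : ℕ) : domCoeff n (n + c)
    = 2 / ((n + c + 1 : ℝ) * (n + c + 2)) * (n / ((n + c) * (c + 1))) := by
  simp [domCoeff]

lemma domCoeff_zero {n : ℕ} (hn : 1 ≤ n) : domCoeff n 0 = 1 := by
  simp [domCoeff_of_le hn]

lemma domCoeff_le (n a : ℕ) : domCoeff n a ≤ 2 / ((a + 1 : ℝ) * (a + 2)) := by
  refine mul_le_of_le_one_right (by positivity) (div_le_one_of_le₀ ?_ (by positivity))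
  have h1 : (n : ℝ) ≤ (max a n : ℕ) := by exact_mod_cast le_max_right a n
  have h2 : (0 : ℝ) ≤ (a - n : ℕ) := by positivity
  nlinarith

lemma summable_domCoeff (n : ℕ) : Summable (domCoeff n) := by
  refine Summable.of_nonneg_of_le (domCoeff_nonneg n) (domCoeff_le n) ?_
  convert! hasSum_one_div_succ_mul.summable.mul_left 2 using 2 with a
  rw [mul_one_div]

lemma sum_telescope {b M : ℕ} (hM : M ≤ b) :
    ∑ m ∈ Finset.range M, 2 / (((b - (m + 1) : ℕ) + 1 : ℝ) * ((b - (m + 1) : ℕ) + 2))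
      = 2 / ((b - M : ℕ) + 1 : ℝ) - 2 / (b + 1) := by
  induction M with
  | zero => simp
  | succ M ih =>
    rw [Finset.sum_range_succ, ih (by omega)]
    obtain ⟨c, rfl⟩ := Nat.exists_eq_add_of_le hM
    rw [show M + 1 + c - M = c + 1 by omega, show M + 1 + c - (M + 1) = c by omega]
    push_cast
    field_simp
    ring

lemma conv_domCoeff_le {n : ℕ} (hn : 1 ≤ n) (b : ℕ) :
    conv n (domCoeff n) b ≤ (b + 1 : ℝ) ^ 2 * domCoeff n b := by
  rw [conv_eq_sum_range, Finset.sum_range_succ', Nat.sub_zero]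
  have h1 := (Finset.sum_le_sum fun m (_ : m ∈ Finset.range (min n b)) =>
    domCoeff_le n (b - (m + 1))).trans_eq (sum_telescope (min_le_right n b))
  have h2 : 2 / ((b - min n b : ℕ) + 1 : ℝ) - 2 / (b + 1) = (b * (b + 2)) * domCoeff n b := by
    rcases le_total b n with h | h
    · rw [min_eq_right h, domCoeff_of_le hn h, Nat.sub_self]
      push_cast
      field_simp
      ring
    · obtain ⟨c, rfl⟩ := Nat.exists_eq_add_of_le h
      have : (0 : ℝ) < n := by positivity
      rw [min_eq_left h, domCoeff_add, Nat.add_sub_cancel_left]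
      push_cast
      field_simp
      ring
  linarith

/-- Coefficients of a power series `h` with zero constant term and `f · h ≤ A ^ (-2) h / 4`
coefficientwise: the solution of the corresponding equation with `1 / (1 - t)` for `f`. -/
noncomputable def decayCoeff (a : ℕ) : ℝ := 24 * a / ((a + 1) * (a + 2) * (a + 3))

lemma decayCoeff_nonneg (a : ℕ) : 0 ≤ decayCoeff a := by unfold decayCoeff; positivity

lemma summable_decayCoeff : Summable decayCoeff := by
  refine Summable.of_nonneg_of_le decayCoeff_nonneg (fun a => ?_)
    (hasSum_one_div_succ_mul.summable.mul_left 24)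
  rw [decayCoeff, mul_one_div, div_le_div_iff₀ (by positivity) (by positivity)]
  have : (0 : ℝ) ≤ (a + 1) * (a + 2) := by positivity
  nlinarith

lemma sum_decayCoeff (b : ℕ) :
    ∑ i ∈ Finset.range (b + 1), decayCoeff i = 6 * b * (b + 1) / ((b + 2) * (b + 3)) := by
  induction b with
  | zero => simp [decayCoeff]
  | succ b ih =>
    rw [Finset.sum_range_succ, ih, decayCoeff]
    push_cast
    field_simp
    ring

lemma two_pow_mul_conv_decayCoeff_le (n b : ℕ) {j : ℕ} (hj : 2 ≤ j) :
    (2 : ℝ) ^ j * conv n decayCoeff b ≤ (b + 1 : ℝ) ^ j * decayCoeff b := by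
  have h1 : conv n decayCoeff b ≤ 6 * b * (b + 1) / ((b + 2) * (b + 3)) := by
    rw [← sum_decayCoeff, ← Finset.sum_range_reflect, conv_eq_sum_range]
    simp only [Nat.add_sub_cancel]
    exact Finset.sum_le_sum_of_subset_of_nonneg (Finset.range_mono (by omega))
      fun _ _ _ => decayCoeff_nonneg _
  rcases b with _ | b
  · have h2 : conv n decayCoeff 0 ≤ 0 := by simpa using h1
    have := mul_nonpos_of_nonneg_of_nonpos (by positivity : (0 : ℝ) ≤ 2 ^ j) h2
    simpa [decayCoeff] using this
  · obtain ⟨i, rfl⟩ := Nat.exists_eq_add_of_le hj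
    have h3 : (2 : ℝ) ^ i ≤ ((b + 1 : ℕ) + 1 : ℝ) ^ i := by
      gcongr
      push_cast
      linarith [(Nat.cast_nonneg b : (0 : ℝ) ≤ b)]
    have h4 : 2 ^ 2 * conv n decayCoeff (b + 1)
        ≤ ((b + 1 : ℕ) + 1 : ℝ) ^ 2 * decayCoeff (b + 1) := by
      refine (mul_le_mul_of_nonneg_left h1 (by norm_num)).trans_eq ?_
      rw [decayCoeff]
      push_cast
      field_simp
      ring
    calc (2 : ℝ) ^ (2 + i) * conv n decayCoeff (b + 1)
        = 2 ^ i * (2 ^ 2 * conv n decayCoeff (b + 1)) := by ring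
      _ ≤ ((b + 1 : ℕ) + 1 : ℝ) ^ i * (((b + 1 : ℕ) + 1 : ℝ) ^ 2 * decayCoeff (b + 1)) :=
        mul_le_mul h3 h4 (mul_nonneg (by positivity) (conv_nonneg decayCoeff_nonneg _))
          (by positivity)
      _ = _ := by ring

/-- The bound that is reverse to `le_wt_one`, up to a constant. -/
lemma wt_one_le (n : ℕ) {k : ℕ → ℕ} (hk : k ∈ THatGe 2) (r : ℕ) :
    wt n k r 1 ≤ (∑' a, decayCoeff a) * (1 / 2) ^ weight k r := by
  have h1 : pairing decayCoeff (wt n k r) ≤ (∑' a, decayCoeff a) * (1 / 2) ^ weight k r := by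
    induction r with
    | zero => simp [pairing, wt, weight]
    | succ r ih =>
      have h := mul_pairing_step_le (n := n) (j := k r) summable_decayCoeff decayCoeff_nonneg
        (wt_nonneg n k r) (wt_antitone n k r)
        (fun b => two_pow_mul_conv_decayCoeff_le n b (hk r))
      rw [wt, weight_succ, pow_add, ← mul_assoc, one_div_pow 2 (k r), mul_one_div,
        le_div_iff₀ (by positivity), mul_comm]
      exact h.trans ih
  refine le_trans ?_ h1
  have h := le_pairing summable_decayCoeff decayCoeff_nonneg (wt_nonneg n k r)
    (wt_antitone n k r) 1
  norm_num [decayCoeff] at h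
  exact h

/-! ### Separation of cylinders -/

/-- Bound for the coefficients of `A ^ (-1) e` beyond degree `n`. The total on the right is less than
`1 / 3`, the coefficient of `t` in `f - A ^ (-1) e`, if `n = 1`; if `n ≥ 2`, the coefficient `1 / 2` of
`t ^ 2` in `f - A ^ (-1) e` already compensates for it. -/
lemma add_one_mul_domCoeff_add_le {n : ℕ} (hn : 1 ≤ n) (c : ℕ) :
    ((c + (n + 1) : ℕ) + 1 : ℝ) * domCoeff n (c + (n + 1))
      ≤ (if n = 1 then 3 / 10 else 1 / 2) * (1 / ((c + 1 : ℝ) * (c + 2))) := by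
  have hc : (0 : ℝ) ≤ c := Nat.cast_nonneg c
  rw [show c + (n + 1) = n + (c + 1) by omega, domCoeff_add]
  have hn0 : (0 : ℝ) < n := by positivity
  have h1 : ((n + (c + 1) : ℕ) + 1 : ℝ) * (2 / ((n + (c + 1 : ℕ) + 1 : ℝ) * (n + (c + 1 : ℕ) + 2)) *
      (n / ((n + (c + 1 : ℕ)) * ((c + 1 : ℕ) + 1))))
      = 2 * n / ((n + c + 1) * (n + c + 3) * (c + 2)) := by
    push_cast
    field_simp
    ring
  rw [h1, mul_one_div]
  split_ifs with h
  · subst h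
    rw [div_le_div_iff₀ (by positivity) (by positivity)]
    push_cast
    have : 0 ≤ (c + 2 : ℝ) * (3 * (1 + c + 1) * (1 + c + 3) - 20 * (c + 1)) :=
      mul_nonneg (by positivity) (by nlinarith [sq_nonneg (c - 1 / 3 : ℝ)])
    linarith
  · rw [div_le_div_iff₀ (by positivity) (by positivity)]
    have : 0 ≤ (c + 2 : ℝ) * ((n + c + 1) * (n + c + 3) - 4 * n * (c + 1)) :=
      mul_nonneg (by positivity) (by nlinarith [sq_nonneg (n - c - 1 : ℝ)])
    linarith

/-- Pointwise this says that `f` exceeds `A ^ (-1) e` by a definite multiple of `t`, for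
`f = 1 + t + ⋯ + t ^ n` and `e` the dominating series: the coefficients of `f - A ^ (-1) e` are
nonnegative up to degree `n` and nonpositive afterwards, and their sum is positive. -/
lemma pairing_domCoeff_step_succ_add_le {n : ℕ} (hn : 1 ≤ n) (j : ℕ) {v : ℕ → ℝ}
    (hv : ∀ a, 0 ≤ v a) (hv' : Antitone v) :
    pairing (domCoeff n) (step n (j + 1) v) + 1 / 30 * (v 1 / 2 ^ j) ≤ step n j v 0 := by
  set w : ℕ → ℝ := fun b => v b / (b + 1 : ℝ) ^ j with hw
  set d : ℕ → ℝ := fun b => (b + 1 : ℝ) * domCoeff n b with hd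
  have hw0 : ∀ b, 0 ≤ w b := fun b => div_nonneg (hv b) (by positivity)
  have hw' : Antitone w := div_pow_antitone hv hv'
  have hd0 : ∀ b, 0 ≤ d b := fun b => mul_nonneg (by positivity) (domCoeff_nonneg n b)
  set θ : ℝ := if n = 1 then 3 / 10 else 1 / 2 with hθ
  have hθs := hasSum_one_div_succ_mul.mul_left θ
  have hdt : Summable fun c => d (c + (n + 1)) :=
    Summable.of_nonneg_of_le (fun c => hd0 _) (add_one_mul_domCoeff_add_le hn) hθs.summable
  have hds : Summable d := (summable_nat_add_iff (n + 1)).1 hdt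
  have hwd : Summable fun b => w b * d b := summable_mul_of_antitone hds hd0 hw0 hw'
  have h1 : pairing (domCoeff n) (step n (j + 1) v) ≤ ∑' b, w b * d b := by
    refine hasSum_le (fun b => ?_)
      (hasSum_step (n := n) (j := j + 1) (summable_domCoeff n) (domCoeff_nonneg n) hv hv')
      hwd.hasSum
    refine (mul_le_mul_of_nonneg_left (conv_domCoeff_le hn b)
      (div_nonneg (hv b) (by positivity))).trans_eq ?_
    simp only [hw, hd, pow_succ]
    field_simp
  have h2 : ∑' c, w (c + (n + 1)) * d (c + (n + 1)) ≤ w 2 * θ := by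
    rw [← mul_one θ, ← hθs.tsum_eq, ← tsum_mul_left]
    refine Summable.tsum_le_tsum (fun c => ?_) ((summable_nat_add_iff (n + 1)).2 hwd)
      (hθs.summable.mul_left _)
    exact mul_le_mul (hw' (by omega)) (add_one_mul_domCoeff_add_le hn c) (hd0 _) (hw0 2)
  have h3 : ∑ b ∈ Finset.range (n + 1), w b * d b + (w 1 / 3 + (if n = 1 then 0 else w 2 / 2))
      ≤ step n j v 0 := by
    have hterm : ∀ b ∈ Finset.range (n + 1), w b - w b * d b = w b * (b / (b + 2)) := by
      intro b hb
      rw [Finset.mem_range] at hb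
      simp only [hd]
      rw [domCoeff_of_le hn (by omega)]
      field_simp
      ring
    have hsub : ∑ b ∈ Finset.range (n + 1), w b * (b / (b + 2) : ℝ)
        = step n j v 0 - ∑ b ∈ Finset.range (n + 1), w b * d b := by
      rw [step_zero_eq, ← Finset.sum_sub_distrib]
      exact Finset.sum_congr rfl fun b hb => (hterm b hb).symm
    have hpos : ∀ b : ℕ, 0 ≤ w b * (b / (b + 2) : ℝ) := fun b => mul_nonneg (hw0 b) (by positivity)
    have hle : w 1 / 3 + (if n = 1 then 0 else w 2 / 2)
        ≤ ∑ b ∈ Finset.range (n + 1), w b * (b / (b + 2) : ℝ) := by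
      split_ifs with h
      · subst h
        norm_num [Finset.sum_range_succ]
        linarith
      · refine le_trans ?_ (Finset.sum_le_sum_of_subset_of_nonneg
          (Finset.range_mono (by omega : 3 ≤ n + 1)) fun b _ _ => hpos b)
        norm_num [Finset.sum_range_succ]
        linarith
    linarith
  have h4 := hwd.sum_add_tsum_nat_add (n + 1)
  have h5 : w 1 = v 1 / 2 ^ j := by simp only [hw]; norm_num
  have h6 : w 2 ≤ w 1 := hw' (by norm_num)
  have h7 := hw0 1
  rw [← h5]
  rw [hθ] at h2
  split_ifs at h2 h3 <;> linarith

lemma THatGe_two_subset : THatGe 2 ⊆ THat := fun _ hk i => one_le_two.trans (hk i)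

lemma eta_le_pairing_domCoeff {n : ℕ} (hn : 1 ≤ n) {k : ℕ → ℕ} (hk : k ∈ THatGe 2) (s : ℕ) :
    eta n k ≤ pairing (domCoeff n) (wt n k s) :=
  le_of_tendsto' (tendsto_wt_zero n (THatGe_two_subset hk)) fun r =>
    wt_zero_le_pairing (summable_domCoeff n) (domCoeff_nonneg n) (domCoeff_zero hn)
      (conv_domCoeff_le hn) hk r s

lemma add_le_eta_of_lt {n : ℕ} (hn : 1 ≤ n) {k l : ℕ → ℕ} (hk : k ∈ THatGe 2)
    (hl : l ∈ THatGe 2) {r : ℕ} (hkl : ∀ i < r, k i = l i) (hr : k r < l r) :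
    eta n l + 1 / 30 * (1 / 2) ^ weight k (r + 1) ≤ eta n k := by
  have hwt := wt_congr (n := n) hkl
  have h1 : eta n l ≤ pairing (domCoeff n) (step n (k r + 1) (wt n k r)) := by
    refine (eta_le_pairing_domCoeff hn hl (r + 1)).trans ?_
    rw [wt, hwt]
    exact pairing_mono (summable_domCoeff n) (domCoeff_nonneg n)
      (step_nonneg (wt_nonneg n l r)) (step_nonneg (wt_nonneg n l r))
      (step_antitone (wt_nonneg n l r) (wt_antitone n l r))
      (step_antitone (wt_nonneg n l r) (wt_antitone n l r))
      (step_le_step hr (wt_nonneg n l r))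
  have h2 := pairing_domCoeff_step_succ_add_le hn (k r) (wt_nonneg n k r) (wt_antitone n k r)
  have h3 : step n (k r) (wt n k r) 0 ≤ eta n k :=
    wt_zero_le_eta n (THatGe_two_subset hk) (r + 1)
  have h4 : (1 / 2 : ℝ) ^ weight k (r + 1) ≤ wt n k r 1 / 2 ^ k r := by
    rw [weight_succ, pow_add, one_div_pow 2 (k r), mul_one_div]
    gcongr
    exact le_wt_one n k r
  linarith

lemma LexSucc_trichotomy (k l : ℕ → ℕ) : LexSucc k l ∨ k = l ∨ LexSucc l k := by
  classical
  by_cases h : ∃ r, k r ≠ l r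
  · have h1 : ∀ i < Nat.find h, k i = l i := fun i hi => not_not.1 (Nat.find_min h hi)
    rcases lt_or_gt_of_ne (Nat.find_spec h) with h2 | h2
    · exact Or.inl ⟨_, h1, h2⟩
    · exact Or.inr (Or.inr ⟨_, fun i hi => (h1 i hi).symm, h2⟩)
  · exact Or.inr (Or.inl (funext fun r => not_not.1 fun hr => h ⟨r, hr⟩))

lemma eta_lt_of_LexSucc {n : ℕ} (hn : 1 ≤ n) {k l : ℕ → ℕ} (hk : k ∈ THatGe 2)
    (hl : l ∈ THatGe 2) (h : LexSucc k l) : eta n l < eta n k := by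
  obtain ⟨r, hkl, hr⟩ := h
  have := add_le_eta_of_lt hn hk hl hkl hr
  have : (0 : ℝ) < (1 / 2) ^ weight k (r + 1) := by positivity
  linarith

lemma eta_lt_iff {n : ℕ} (hn : 1 ≤ n) {k l : ℕ → ℕ} (hk : k ∈ THatGe 2) (hl : l ∈ THatGe 2) :
    eta n l < eta n k ↔ LexSucc k l := by
  refine ⟨fun h => ?_, eta_lt_of_LexSucc hn hk hl⟩
  rcases LexSucc_trichotomy k l with h1 | rfl | h1
  · exact h1
  · exact absurd h (lt_irrefl _)
  · exact absurd h (eta_lt_of_LexSucc hn hl hk h1).asymm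

lemma eta_injOn {n : ℕ} (hn : 1 ≤ n) : Set.InjOn (eta n) (THatGe 2) := by
  intro k hk l hl h
  rcases LexSucc_trichotomy k l with h1 | h1 | h1
  · exact absurd h (eta_lt_of_LexSucc hn hk hl h1).ne'
  · exact h1
  · exact absurd h (eta_lt_of_LexSucc hn hl hk h1).ne

/-! ### Expansions in powers of the inverse golden ratio -/

/-- The inverse of the golden ratio: the positive root of `q + q ^ 2 = 1`. -/
noncomputable def invGolden : ℝ := Real.goldenRatio⁻¹

/-- The dimension `log ((1 + √5) / 2) / log 2`, characterized by `(1 / 2) ^ goldenDim = invGolden`. -/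
noncomputable def goldenDim : ℝ := Real.log ((1 + √5) / 2) / Real.log 2

lemma invGolden_pos : 0 < invGolden := inv_pos.2 Real.goldenRatio_pos

lemma invGolden_sq : invGolden ^ 2 = 1 - invGolden := by
  have h := Real.goldenRatio_sq
  have h0 := Real.goldenRatio_ne_zero
  rw [invGolden, inv_pow, h]
  have h1 : Real.goldenRatio + 1 ≠ 0 := by linarith [Real.goldenRatio_pos]
  generalize Real.goldenRatio = φ at h h0 h1 ⊢
  field_simp
  linear_combination -h

lemma invGolden_lt_one : invGolden < 1 := by
  have := pow_pos invGolden_pos 2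
  linarith [invGolden_sq]

lemma goldenDim_pos : 0 < goldenDim :=
  div_pos (Real.log_pos Real.one_lt_goldenRatio) (Real.log_pos one_lt_two)

lemma half_pow_rpow_goldenDim (N : ℕ) : (((1 / 2 : ℝ) ^ N) ^ goldenDim) = invGolden ^ N := by
  have h : (1 / 2 : ℝ) ^ goldenDim = invGolden := by
    have h2 : Real.log 2 ≠ 0 := (Real.log_pos one_lt_two).ne'
    rw [Real.rpow_def_of_pos (by norm_num), one_div, Real.log_inv, goldenDim, neg_mul,
      mul_div_cancel₀ _ h2, Real.exp_neg, Real.exp_log Real.goldenRatio_pos]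
    rfl
  rw [← Real.rpow_natCast, ← Real.rpow_mul (by norm_num), mul_comm, Real.rpow_mul (by norm_num), h,
    Real.rpow_natCast]

lemma hasSum_invGolden : HasSum (fun i : ℕ => invGolden ^ (i + 2)) 1 := by
  have h := (hasSum_geometric_of_lt_one invGolden_pos.le invGolden_lt_one).mul_left (invGolden ^ 2)
  have h1 : 1 - invGolden ≠ 0 := by linarith [invGolden_lt_one]
  rw [invGolden_sq, mul_inv_cancel₀ h1, ← invGolden_sq] at h
  simpa only [← pow_add, add_comm 2] using h

lemma hasSum_invGolden_even : HasSum (fun i : ℕ => invGolden ^ (2 * (i + 1))) invGolden := by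
  have hq := invGolden_pos
  have h0 : invGolden ^ 2 < 1 := by linarith [invGolden_sq]
  have h := (hasSum_geometric_of_lt_one (sq_nonneg invGolden) h0).mul_left (invGolden ^ 2)
  have h1 : invGolden ^ 2 * (1 - invGolden ^ 2)⁻¹ = invGolden := by
    have : 1 - invGolden ^ 2 = invGolden := by linarith [invGolden_sq]
    rw [this]
    field_simp
  rw [h1] at h
  simpa only [pow_mul, pow_succ'] using h

lemma weight_add_le {k : ℕ → ℕ} (hk : k ∈ THatGe 2) (r i : ℕ) :
    weight k r + 2 * i ≤ weight k (i + r) := by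
  induction i with
  | zero => simp
  | succ i ih =>
    have := hk (i + r)
    rw [Nat.add_right_comm, weight_succ]
    omega

/-- The number `∑ q ^ (k₁ + ⋯ + k_j)`, with `q` the inverse golden ratio. -/
noncomputable def goldenExpansion (k : ℕ → ℕ) : ℝ := ∑' j, invGolden ^ weight k (j + 1)

lemma invGolden_pow_weight_le {k : ℕ → ℕ} (hk : k ∈ THatGe 2) (r j : ℕ) :
    invGolden ^ weight k (j + r + 1) ≤ invGolden ^ weight k r * invGolden ^ (2 * (j + 1)) := by
  rw [← pow_add]
  refine pow_le_pow_of_le_one invGolden_pos.le invGolden_lt_one.le ?_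
  rw [Nat.add_right_comm]
  exact weight_add_le hk r (j + 1)

lemma summable_goldenExpansion {k : ℕ → ℕ} (hk : k ∈ THatGe 2) :
    Summable fun j => invGolden ^ weight k (j + 1) :=
  Summable.of_nonneg_of_le (fun _ => pow_nonneg invGolden_pos.le _)
    (fun j => by simpa [weight] using invGolden_pow_weight_le hk 0 j)
    hasSum_invGolden_even.summable

lemma goldenExpansion_mem {k : ℕ → ℕ} (hk : k ∈ THatGe 2) (r : ℕ) :
    goldenExpansion k ∈ Set.Icc (∑ j ∈ Finset.range r, invGolden ^ weight k (j + 1))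
      (∑ j ∈ Finset.range r, invGolden ^ weight k (j + 1)
        + invGolden ^ weight k r * invGolden) := by
  have hs := summable_goldenExpansion hk
  rw [goldenExpansion, ← hs.sum_add_tsum_nat_add r]
  constructor
  · have : 0 ≤ ∑' j, invGolden ^ weight k (j + r + 1) :=
      tsum_nonneg fun _ => pow_nonneg invGolden_pos.le _
    linarith
  · have h := hasSum_invGolden_even.mul_left (invGolden ^ weight k r)
    have := hasSum_le (invGolden_pow_weight_le hk r)
      ((summable_nat_add_iff r).2 hs).hasSum h
    linarith

lemma abs_goldenExpansion_sub_le {k l : ℕ → ℕ} (hk : k ∈ THatGe 2) (hl : l ∈ THatGe 2) {r : ℕ}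
    (hkl : ∀ i < r, k i = l i) (hr : k r < l r) :
    |goldenExpansion k - goldenExpansion l| ≤ 2 * invGolden ^ weight k (r + 1) := by
  have hq := invGolden_pos
  have hw : ∀ j ≤ r, weight k j = weight l j := fun j hj =>
    Finset.sum_congr rfl fun i hi => hkl i (by rw [Finset.mem_range] at hi; omega)
  have hS : ∑ j ∈ Finset.range r, invGolden ^ weight k (j + 1)
      = ∑ j ∈ Finset.range r, invGolden ^ weight l (j + 1) :=
    Finset.sum_congr rfl fun j hj => by
      rw [hw _ (by rw [Finset.mem_range] at hj; omega)]
  have h1 := goldenExpansion_mem hk (r + 1)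
  have h2 := goldenExpansion_mem hl (r + 1)
  rw [Finset.sum_range_succ] at h1 h2
  rw [← hS] at h2
  have hlt : invGolden ^ weight l (r + 1) ≤ invGolden ^ weight k (r + 1) * invGolden := by
    rw [← pow_succ]
    refine pow_le_pow_of_le_one hq.le invGolden_lt_one.le ?_
    rw [weight_succ, weight_succ, hw r le_rfl]
    omega
  have hp : 0 < invGolden ^ weight k (r + 1) := by positivity
  have hp' : 0 < invGolden ^ weight l (r + 1) := by positivity
  have h3 : invGolden ^ weight k (r + 1) * invGolden ≤ invGolden ^ weight k (r + 1) :=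
    mul_le_of_le_one_right hp.le invGolden_lt_one.le
  have h4 : invGolden ^ weight l (r + 1) * invGolden ≤ invGolden ^ weight l (r + 1) :=
    mul_le_of_le_one_right hp'.le invGolden_lt_one.le
  have h5 : invGolden ^ weight l (r + 1) * (1 + invGolden) ≤ invGolden ^ weight k (r + 1) := by
    refine (mul_le_mul_of_nonneg_right hlt (by positivity)).trans_eq ?_
    linear_combination invGolden ^ weight k (r + 1) * invGolden_sq
  rw [abs_le]
  constructor <;> linarith [h1.1, h1.2, h2.1, h2.2]

/-- Every number in `(0, q]` has an expansion, found greedily. -/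
lemma Ioc_subset_image_goldenExpansion :
    Set.Ioc 0 invGolden ⊆ goldenExpansion '' THatGe 2 := by
  classical
  have hq := invGolden_pos
  rintro y hy
  obtain ⟨k, z, hz0, hzs, hz⟩ := exists_orbit
    (fun j (z : ℝ) => (z - invGolden ^ j) / invGolden ^ j) (fun z => z ∈ Set.Ioc 0 invGolden)
    (fun j _ => 2 ≤ j)
    (fun z hz => by
      have hlim : Tendsto (fun j : ℕ => invGolden ^ (j + 2)) atTop (𝓝 0) :=
        (tendsto_add_atTop_iff_nat 2).2 (tendsto_pow_atTop_nhds_zero_of_lt_one hq.le invGolden_lt_one)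
      have hex : ∃ j : ℕ, invGolden ^ (j + 2) < z := (hlim.eventually_lt_const hz.1).exists
      have hspec := Nat.find_spec hex
      have hle : z ≤ invGolden ^ (Nat.find hex + 1) := by
        rcases Nat.eq_zero_or_pos (Nat.find hex) with h | h
        · rw [h, zero_add, pow_one]
          exact hz.2
        · have := not_lt.1 (Nat.find_min hex (m := Nat.find hex - 1) (by omega))
          rwa [show Nat.find hex - 1 + 2 = Nat.find hex + 1 by omega] at this
      have hp : 0 < invGolden ^ (Nat.find hex + 2) := by positivity
      refine ⟨Nat.find hex + 2, by omega, div_pos (by linarith) hp, ?_⟩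
      rw [div_le_iff₀ hp]
      have : invGolden ^ (Nat.find hex + 1)
          = invGolden * invGolden ^ (Nat.find hex + 2) + invGolden ^ (Nat.find hex + 2) := by
        rw [pow_succ, pow_add]
        linear_combination (-(invGolden ^ Nat.find hex) * (invGolden + 1)
          + invGolden ^ Nat.find hex) * invGolden_sq
      linarith)
    y hy
  have hk : k ∈ THatGe 2 := fun i => (hz i).2
  refine ⟨k, hk, ?_⟩
  have hS : ∀ r, ∑ j ∈ Finset.range r, invGolden ^ weight k (j + 1)
      = y - invGolden ^ weight k r * z r := by
    intro r
    induction r with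
    | zero => simp [weight, hz0]
    | succ r ih =>
      rw [Finset.sum_range_succ, ih, hzs, weight_succ, pow_add]
      field_simp
      ring
  have h0 : Tendsto (fun r => invGolden ^ weight k r * z r) atTop (𝓝 0) := by
    refine squeeze_zero (fun r => mul_nonneg (by positivity) (hz r).1.1.le) (fun r => ?_)
      (tendsto_pow_atTop_nhds_zero_of_lt_one hq.le invGolden_lt_one)
    refine (mul_le_of_le_one_right (by positivity)
      ((hz r).1.2.trans invGolden_lt_one.le)).trans ?_
    refine pow_le_pow_of_le_one hq.le invGolden_lt_one.le ?_
    have := weight_add_le hk 0 r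
    rw [Nat.add_zero] at this
    omega
  have h1 := (summable_goldenExpansion hk).hasSum.tendsto_sum_nat
  simp only [hS] at h1
  exact tendsto_nhds_unique h1 (by simpa using h0.const_sub y)

/-! ### The Hausdorff dimension -/

lemma tsum_pi_prod (x : ℕ → ENNReal) (r : ℕ) :
    ∑' c : Fin r → ℕ, ∏ i, x (c i) = (∑' a, x a) ^ r := by
  induction r with
  | zero => simp
  | succ r ih =>
    rw [← (Fin.consEquiv (fun _ : Fin (r + 1) => ℕ)).tsum_eq, pow_succ', ← ih,
      ← ENNReal.tsum_mul_right]
    simp only [Fin.prod_univ_succ, Fin.consEquiv, Equiv.coe_fn_mk, Fin.cons_zero, Fin.cons_succ]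
    rw [ENNReal.tsum_prod (f := fun a (c : Fin r → ℕ) => x a * ∏ i, x (c i))]
    simp only [ENNReal.tsum_mul_left]

/-- The sequence with entries `c i + 2` for `i < r`, continued by `2`. -/
def extendTwo {r : ℕ} (c : Fin r → ℕ) (i : ℕ) : ℕ := if h : i < r then c ⟨i, h⟩ + 2 else 2

lemma extendTwo_mem {r : ℕ} (c : Fin r → ℕ) : extendTwo c ∈ THatGe 2 := by
  intro i
  unfold extendTwo
  split_ifs <;> omega

lemma extendTwo_eq {k : ℕ → ℕ} (hk : k ∈ THatGe 2) {r i : ℕ} (hi : i < r) :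
    extendTwo (fun j : Fin r => k j - 2) i = k i := by
  have := hk i
  simp only [extendTwo, hi, dif_pos]
  omega

lemma weight_extendTwo {r : ℕ} (c : Fin r → ℕ) : weight (extendTwo c) r = ∑ i, (c i + 2) := by
  rw [weight, Finset.sum_range]
  exact Finset.sum_congr rfl fun i _ => by simp [extendTwo]

/-- The values on the cylinder of the first `r` entries of `k` lie in an interval whose length is
comparable to `2 ^ (-(k₁ + ⋯ + k_r))`. -/
lemma eta_le_add {n : ℕ} {k : ℕ → ℕ} (hk : k ∈ THatGe 2) (r : ℕ) :
    eta n k ≤ wt n k r 0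
      + (∑' a, decayCoeff a) * Real.exp (H n) * (1 / 2) ^ weight k r := by
  have h1 := (eta_le_pairing_expCoeff n (THatGe_two_subset hk) r).trans
    (pairing_le_add (hasSum_expCoeff n).summable (expCoeff_nonneg n) (expCoeff_zero n)
      (wt_nonneg n k r) (wt_antitone n k r))
  rw [(hasSum_expCoeff n).tsum_eq] at h1
  have h2 := mul_le_mul_of_nonneg_right (wt_one_le n hk r) (Real.exp_pos (H n)).le
  linarith

/-- The cylinders of length `r` cover, and since `∑_{k ≥ 2} q ^ k = 1` for the inverse golden ratio
`q = 2 ^ (-goldenDim)`, the sums of the powers `goldenDim` of their lengths stay bounded. -/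
lemma dimH_le_goldenDim (n : ℕ) :
    dimH (eta n '' THatGe 2) ≤ ENNReal.ofReal goldenDim := by
  set D : ℝ := (∑' a, decayCoeff a) * Real.exp (H n) with hD
  have hD0 : 0 ≤ D := mul_nonneg (tsum_nonneg decayCoeff_nonneg) (Real.exp_pos _).le
  refine dimH_le_of_hausdorffMeasure_ne_top (d := goldenDim.toNNReal) ?_
  rw [Real.coe_toNNReal _ goldenDim_pos.le]
  let t : ∀ r : ℕ, (Fin r → ℕ) → Set ℝ := fun r c =>
    Set.Icc (wt n (extendTwo c) r 0)
      (wt n (extendTwo c) r 0 + D * (1 / 2) ^ weight (extendTwo c) r)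
  have hdiam : ∀ r c, Metric.ediam (t r c)
      = ENNReal.ofReal (D * (1 / 2) ^ weight (extendTwo c) r) := fun r c => by
    rw [Real.ediam_Icc, add_sub_cancel_left]
  have hsum : ∀ r, ∑' c, Metric.ediam (t r c) ^ goldenDim = ENNReal.ofReal (D ^ goldenDim) := by
    intro r
    have hterm : ∀ c : Fin r → ℕ, Metric.ediam (t r c) ^ goldenDim
        = ENNReal.ofReal (D ^ goldenDim) * ∏ i, ENNReal.ofReal (invGolden ^ (c i + 2)) := by
      intro c
      rw [hdiam, ENNReal.ofReal_rpow_of_nonneg (by positivity) goldenDim_pos.le,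
        Real.mul_rpow hD0 (by positivity), half_pow_rpow_goldenDim,
        ENNReal.ofReal_mul (by positivity), weight_extendTwo,
        ← Finset.prod_pow_eq_pow_sum,
        ENNReal.ofReal_prod_of_nonneg fun _ _ => pow_nonneg invGolden_pos.le _]
    simp only [hterm]
    rw [ENNReal.tsum_mul_left, tsum_pi_prod (fun a => ENNReal.ofReal (invGolden ^ (a + 2))),
      ← ENNReal.ofReal_tsum_of_nonneg (fun _ => pow_nonneg invGolden_pos.le _)
        hasSum_invGolden.summable, hasSum_invGolden.tsum_eq]
    simp
  have hlim : Tendsto (fun r : ℕ => ENNReal.ofReal (D * (1 / 2) ^ r)) atTop (𝓝 0) := by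
    have := (tendsto_pow_atTop_nhds_zero_of_lt_one (r := (1 / 2 : ℝ)) (by norm_num)
      (by norm_num)).const_mul D
    simpa using ENNReal.tendsto_ofReal this
  have h := Measure.hausdorffMeasure_le_liminf_tsum goldenDim (eta n '' THatGe 2)
    (fun r : ℕ => ENNReal.ofReal (D * (1 / 2) ^ r)) hlim t
    (Eventually.of_forall fun r c => by
      rw [hdiam]
      refine ENNReal.ofReal_le_ofReal (mul_le_mul_of_nonneg_left ?_ hD0)
      refine pow_le_pow_of_le_one (by norm_num) (by norm_num) ?_
      have := weight_add_le (extendTwo_mem c) 0 r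
      rw [Nat.add_zero] at this
      omega)
    (Eventually.of_forall fun r => by
      rintro _ ⟨k, hk, rfl⟩
      refine Set.mem_iUnion.2 ⟨fun j : Fin r => k j - 2, ?_⟩
      have hwt := wt_congr (n := n) (fun i hi => extendTwo_eq hk (r := r) (i := i) hi)
      have hw : weight (extendTwo fun j : Fin r => k j - 2) r = weight k r :=
        Finset.sum_congr rfl fun i hi => extendTwo_eq hk (Finset.mem_range.1 hi)
      change _ ∈ Set.Icc _ _
      rw [hwt, hw]
      exact ⟨wt_zero_le_eta n (THatGe_two_subset hk) r, eta_le_add hk r⟩)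
  simp only [hsum, liminf_const] at h
  exact ne_top_of_le_ne_top ENNReal.ofReal_ne_top h

/-- The map `eta n k ↦ goldenExpansion k` is Hölder continuous of exponent `goldenDim`, and its
image contains an interval. -/
lemma goldenDim_le_dimH {n : ℕ} (hn : 1 ≤ n) :
    ENNReal.ofReal goldenDim ≤ dimH (eta n '' THatGe 2) := by
  set g : ℝ → ℝ := goldenExpansion ∘ Function.invFunOn (eta n) (THatGe 2) with hg
  have hgk : ∀ k ∈ THatGe 2, g (eta n k) = goldenExpansion k := fun k hk =>
    congrArg goldenExpansion ((eta_injOn hn).leftInvOn_invFunOn hk)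
  have hs := goldenDim_pos
  -- the case of ordered sequences, to which the Hölder estimate reduces by symmetry
  have key : ∀ k ∈ THatGe 2, ∀ l ∈ THatGe 2, LexSucc k l →
      |goldenExpansion k - goldenExpansion l|
        ≤ 2 * 30 ^ goldenDim * |eta n k - eta n l| ^ goldenDim := by
    rintro k hk l hl ⟨r, hkl, hr⟩
    refine (abs_goldenExpansion_sub_le hk hl hkl hr).trans ?_
    rw [mul_assoc, ← Real.mul_rpow (by norm_num) (abs_nonneg _), ← half_pow_rpow_goldenDim]
    have h1 := add_le_eta_of_lt hn hk hl hkl hr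
    have h2 : (1 / 2 : ℝ) ^ weight k (r + 1) ≤ 30 * |eta n k - eta n l| := by
      linarith [le_abs_self (eta n k - eta n l)]
    gcongr
  have hholder : HolderOnWith (2 * 30 ^ goldenDim : ℝ).toNNReal goldenDim.toNNReal g
      (eta n '' THatGe 2) := by
    rintro _ ⟨k, hk, rfl⟩ _ ⟨l, hl, rfl⟩
    have h : |goldenExpansion k - goldenExpansion l|
        ≤ 2 * 30 ^ goldenDim * |eta n k - eta n l| ^ goldenDim := by
      rcases LexSucc_trichotomy k l with h | rfl | h
      · exact key k hk l hl h
      · simp [Real.zero_rpow hs.ne']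
      · rw [abs_sub_comm, abs_sub_comm (eta n k)]
        exact key l hl k hk h
    rw [hgk k hk, hgk l hl, edist_dist, edist_dist, Real.dist_eq, Real.dist_eq,
      Real.coe_toNNReal _ hs.le, ENNReal.ofReal_rpow_of_nonneg (abs_nonneg _) hs.le]
    change _ ≤ ENNReal.ofReal _ * _
    rw [← ENNReal.ofReal_mul (by positivity)]
    exact ENNReal.ofReal_le_ofReal h
  have himage : Set.Ioc 0 invGolden ⊆ g '' (eta n '' THatGe 2) := by
    intro y hy
    obtain ⟨k, hk, rfl⟩ := Ioc_subset_image_goldenExpansion hy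
    exact ⟨eta n k, ⟨k, hk, rfl⟩, hgk k hk⟩
  have h1 : dimH (Set.Ioc 0 invGolden) = 1 := by
    rw [Real.dimH_of_nonempty_interior]
    · simp
    · rw [interior_Ioc]
      exact Set.nonempty_Ioo.2 invGolden_pos
  have h2 := (dimH_mono himage).trans (hholder.dimH_image_le (Real.toNNReal_pos.2 hs))
  have h0 : (goldenDim.toNNReal : ENNReal) ≠ 0 := by
    simpa using hs
  rwa [h1, ENNReal.le_div_iff_mul_le (Or.inl h0) (Or.inl ENNReal.coe_ne_top), one_mul] at h2

end RatDef

theorem theorem1p1 (n : ℕ) (hn : 1 ≤ n) :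
    -- the map `η_n` is well defined: the limit exists and lies in `(1, ∞)`
    (∀ k ∈ RatDef.THat,
      Tendsto (fun r => RatDef.T n k r) atTop (𝓝 (RatDef.eta n k)) ∧ 1 < RatDef.eta n k) ∧
    -- (i)
    (RatDef.eta n '' (RatDef.THat \ RatDef.THatR) = Set.Ioc 1 (Real.exp (RatDef.H n)) ∧
      RatDef.eta n '' RatDef.THatR ⊆ Set.Ioo 1 (Real.exp (RatDef.H n)) ∧
      RatDef.eta n (fun _ => 1) = Real.exp (RatDef.H n)) ∧
    -- (ii)
    (∀ k ∈ RatDef.THatGe 2, ∀ l ∈ RatDef.THatGe 2,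
      (RatDef.eta n k > RatDef.eta n l ↔ RatDef.LexSucc k l)) ∧
    -- (iii)
    dimH (RatDef.eta n '' RatDef.THatGe 2) =
      ENNReal.ofReal (Real.log ((1 + √5) / 2) / Real.log 2) := by
  refine ⟨fun k hk => ⟨?_, RatDef.one_lt_eta hn hk⟩,
    ⟨Set.Subset.antisymm ?_ fun x hx => RatDef.exists_eta_eq hn hx, ?_, RatDef.eta_const_one hn⟩,
    fun k hk l hl => RatDef.eta_lt_iff hn hk hl,
    le_antisymm (RatDef.dimH_le_goldenDim n) (RatDef.goldenDim_le_dimH hn)⟩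
  · simpa only [RatDef.T_eq_wt] using RatDef.tendsto_wt_zero n hk
  · rintro _ ⟨k, hk, rfl⟩
    exact ⟨RatDef.one_lt_eta hn hk.1, RatDef.eta_le_exp n hk.1⟩
  · rintro _ ⟨k, hk, rfl⟩
    obtain ⟨s, hs, -⟩ := hk.2
    exact ⟨RatDef.one_lt_eta hn hk.1, RatDef.eta_lt_exp hn hk.1 hs⟩
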